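/- **Model.** $N$ D2D pairs share one channel; in each time slot $t=0,1,2,\dots$ exactly one user is scheduled. The fading vectors $H(t)=(h_1(t),\dots,h_N(t))$ are i.i.d. over $t$ with a known law $\nu$ whose marginals are standard complex Gaussian. User $n$ can use a bit rate $\mathsf R_m\ge 0$ ($m=1,\dots,M$), which costs the power $P_{n,m}=\min\{\mathsf S_mN_o/(|h_n|^2L_n),P_{\max}\}$, where $\mathsf S_m\ge0$ and $N_o,L_n,P_{\max}>0$. If $n$ is scheduled at level $m$ in slot $t$, then $P_n(t)=P_{n,m}$ and $R_n(t)=\mathsf R_m$; for the other users $P_n(t)=R_n(t)=0$. **Centralized limited-feedback policies.** Let $1\le K^{(1)}\le N$. In every slot the base station chooses a set of at most $K^{(1)}$ users from its prior information (statistics, initial queues and possibly randomization, jointly independent of the channels) and the CSI reported in earlier slots. It receives the current CSI of these users only, and then schedules one of them at some level, as a function of all it has been told so far. A policy is feasible if $\liminf_{T}\frac1T\sum_{t=1}^T\mathbb E[R_n(t)]\ge R_{th}$ for all $n$, where $R_{th}\ge0$. Let $P_c^*$ be the infimum of $\limsup_T\frac1T\sum_{t=1}^T\sum_n\mathbb E[P_n(t)]$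 over feasible policies; assume that a feasible policy exists. **Algorithm $\Gamma^{cent}$.** Let $V>0$, and let $Q_n(t+1)=[Q_n(t)-R_n(t)]^++R_{th}$, with $Q_n(0)\ge0$ square integrable and part of the prior information. In slot $t$: 1. choose a set $\Lambda^*$ minimizing $\mathbb E_{h\sim\nu}\big[\min_{n\in\Lambda}\min_m (VP_{n,m}(h_n)-Q_n(t)\mathsf R_m)\big]$ over the sets $\Lambda$ of exactly $K^{(1)}$ users; 2. each $n\in\Lambda^*$ picks a level minimizing $VP_{n,m}-Q_n(t)\mathsf R_m$, and reports the rate $R_n$ and a quantized version $\tilde P_n=q(P_n)$ of the power $P_n$ at this level; 3. schedule, at the level it picked, a user in $\Lambda^*$ minimizing $V\tilde P_n-Q_n(t)R_n$. Ties are broken arbitrarily (as a centralized limited-feedback policy). Let $\delta$ be a bound on the quantization error: $|q(p)-p|\le\delta$ for $0\le p\le P_{\max}$. **Claim.** There is a finite $C$, independent of $V$, of $Q(0)$, of the quantizer and of the tie-breaking, such that under $\Gamma^{cent}$, for all $t$, almost surely $$\mathbb E\Big[\sum_{i=1}^N\tfrac{R_{th}^2+R_i(t)^2}{2}\,\Big|\,Q(t)\Big]\le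 C .$$ For every $C$ with this property, $$P_c^*\le\limsup_{T\to\infty}\frac1T\sum_{t=1}^T\sum_{n=1}^N\mathbb E\big[P_n(\Gamma^{cent}(t))\big]\le P_c^*+\frac CV+2\delta .$$ In particular, if powers are reported exactly ($\delta=0$), the upper bound is $P_c^*+C/V$. -/

import Mathlib

open MeasureTheory ProbabilityTheory Filter

noncomputable section

namespace D2D

/-- Physical parameters of a cell with `N` device-to-device pairs and `M` bit-rate levels:
SNR thresholds, bit rates, path losses, noise power, maximal power, throughput threshold. -/
structure Params (N M : ℕ) where
  snr : Fin M → ℝ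
  bitRate : Fin M → ℝ
  pathLoss : Fin N → ℝ
  noise : ℝ
  pmax : ℝ
  rth : ℝ
  snr_nonneg : ∀ m, 0 ≤ snr m
  bitRate_nonneg : ∀ m, 0 ≤ bitRate m
  pathLoss_pos : ∀ n, 0 < pathLoss n
  noise_pos : 0 < noise
  pmax_pos : 0 < pmax
  rth_nonneg : 0 ≤ rth

/-- Transmission power of pair `n` at level `m` when its fading coefficient is `z`.
(The value at `z = 0` is irrelevant: this has probability zero under Rayleigh fading.) -/
def Params.power {N M : ℕ} (par : Params N M) (n : Fin N) (m : Fin M) (z : ℂ) : ℝ :=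
  min (par.snr m * par.noise / (‖z‖ ^ 2 * par.pathLoss n)) par.pmax

/-- The circularly symmetric complex Gaussian law with mean zero and unit variance: real and
imaginary parts are independent centred real Gaussians of variance `1 / 2`. -/
def stdComplexGaussian : Measure ℂ :=
  ((gaussianReal 0 (1 / 2)).prod (gaussianReal 0 (1 / 2))).map
    (fun p : ℝ × ℝ => (p.1 : ℂ) + (p.2 : ℂ) * Complex.I)

/-- `H t` is the vector of fading coefficients in slot `t`. The vectors are independent and
identically distributed over time with law `ν` (the statistical CSI), and every link is a Rayleigh
fading channel. Nothing is assumed on the dependence between different links. The σ-algebra `𝓐`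
is whatever the base station may know beforehand (initial queues, randomization); it is independent
of the channels. -/
structure IsFadingModel {N : ℕ} {Ω : Type*} (𝓐 : MeasurableSpace Ω) [mΩ : MeasurableSpace Ω]
    (μ : Measure Ω) (ν : Measure (Fin N → ℂ)) (H : ℕ → Ω → Fin N → ℂ) : Prop where
  measurable : ∀ t, Measurable[mΩ] (H t)
  law : ∀ t, μ.map (H t) = ν
  rayleigh : ∀ n, ν.map (fun h => h n) = stdComplexGaussian
  iIndep : iIndepFun H μ
  prior_le : 𝓐 ≤ mΩ
  prior_indep : Indep 𝓐 (⨆ t, MeasurableSpace.comap (H t) inferInstance) μ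

/-- The CSI received by the base station in slot `t` if the users in `Λ t` report: the fading
coefficients of the reporting users (all other coordinates are blanked). -/
def report {N : ℕ} {Ω : Type*} (H : ℕ → Ω → Fin N → ℂ) (Λ : ℕ → Ω → Finset (Fin N))
    (t : ℕ) (ω : Ω) : Fin N → ℂ :=
  fun n => if n ∈ Λ t ω then H t ω n else 0

/-- What the base station knows at the start of slot `t`: its prior information and the reports of
all earlier slots. -/
abbrev known {N : ℕ} {Ω : Type*} (H : ℕ → Ω → Fin N → ℂ) (𝓐 : MeasurableSpace Ω)
    (Λ : ℕ → Ω → Finset (Fin N)) (t : ℕ) : MeasurableSpace Ω :=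
  𝓐 ⊔ ⨆ s : Fin t, MeasurableSpace.comap (report H Λ s) inferInstance

/-- A centralized limited-feedback policy. In slot `t` the base station first requests the CSI of at
most `K` users (set `feedback t`), knowing only what was reported in earlier slots; having received
these reports, it schedules one of the reporting users (`user t`) at one of the bit-rate levels
(`level t`). The choices may depend on time and on the whole past, and may be randomized through
`𝓐`. -/
structure Policy {N : ℕ} {Ω : Type*} (M K : ℕ) (H : ℕ → Ω → Fin N → ℂ)
    (𝓐 : MeasurableSpace Ω) where
  feedback : ℕ → Ω → Finset (Fin N)
  user : ℕ → Ω → Fin N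
  level : ℕ → Ω → Fin M
  card_feedback_le : ∀ t ω, (feedback t ω).card ≤ K
  user_mem : ∀ t ω, user t ω ∈ feedback t ω
  feedback_measurable : ∀ t (A : Finset (Fin N)),
    MeasurableSet[known H 𝓐 feedback t] {ω | feedback t ω = A}
  decision_measurable : ∀ t n m,
    MeasurableSet[known H 𝓐 feedback (t + 1)] {ω | user t ω = n ∧ level t ω = m}

section Performance

variable {N M K : ℕ} {Ω : Type*} {H : ℕ → Ω → Fin N → ℂ} {𝓐 : MeasurableSpace Ω}

/-- The transmission power `P_n(t)`; only the scheduled user transmits. -/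
def Policy.txPower (par : Params N M) (π : Policy M K H 𝓐) (t : ℕ) (n : Fin N) (ω : Ω) : ℝ :=
  if π.user t ω = n then par.power n (π.level t ω) (H t ω n) else 0

/-- The service rate `R_n(t)`; only the scheduled user is served. -/
def Policy.rate (par : Params N M) (π : Policy M K H 𝓐) (t : ℕ) (n : Fin N) (ω : Ω) : ℝ :=
  if π.user t ω = n then par.bitRate (π.level t ω) else 0

/-- Limsup time-average expected total power. -/
def Policy.limsupPower [MeasurableSpace Ω] (par : Params N M) (μ : Measure Ω)
    (π : Policy M K H 𝓐) : ℝ :=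
  limsup (fun T : ℕ => (1 / (T : ℝ)) *
    ∑ t ∈ Finset.Icc 1 T, ∑ n, ∫ ω, π.txPower par t n ω ∂μ) atTop

/-- The throughput constraint: every user has liminf time-average expected rate at least `rth`. -/
def Policy.Feasible [MeasurableSpace Ω] (par : Params N M) (μ : Measure Ω)
    (π : Policy M K H 𝓐) : Prop :=
  ∀ n, par.rth ≤ liminf (fun T : ℕ => (1 / (T : ℝ)) *
    ∑ t ∈ Finset.Icc 1 T, ∫ ω, π.rate par t n ω ∂μ) atTop

/-- The virtual queues `Q(t+1) = [Q(t) - R(t)]⁺ + rth` driven by a policy, started at `Q₀`. -/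
def Policy.queue (par : Params N M) (π : Policy M K H 𝓐) (Q₀ : Ω → Fin N → ℝ) :
    ℕ → Ω → Fin N → ℝ
  | 0 => Q₀
  | t + 1 => fun ω n => max (π.queue par Q₀ t ω n - π.rate par t n ω) 0 + par.rth

/-- `C` bounds the conditional second moment of arrivals and services given the queues, i.e. the
expectation of `∑ (rth² + R_i(t)²) / 2` conditionally on `Q(t)`, in every slot. -/
def Policy.IsDriftConstant [MeasurableSpace Ω] (par : Params N M) (μ : Measure Ω)
    (π : Policy M K H 𝓐) (Q₀ : Ω → Fin N → ℝ) (C : ℝ) : Prop :=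
  ∀ t, ∀ᵐ ω ∂μ,
    (μ[fun ω' => ∑ i, (par.rth ^ 2 + π.rate par t i ω' ^ 2) / 2 |
      MeasurableSpace.comap (π.queue par Q₀ t) inferInstance]) ω ≤ C

end Performance

/-- The optimal value of the scheduling problem over all centralized limited-feedback policies. -/
def optimalPower {N M : ℕ} {Ω : Type*} (𝓐 : MeasurableSpace Ω) [MeasurableSpace Ω]
    (par : Params N M) (K : ℕ) (μ : Measure Ω) (H : ℕ → Ω → Fin N → ℂ) : ℝ :=
  sInf {x | ∃ π : Policy M K H 𝓐, π.Feasible par μ ∧ π.limsupPower par μ = x}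

/-- The expected best metric of the subset `Λ` when the queues are `Q`: the expectation, under the
channel statistics, of the minimum over `n ∈ Λ` of `V P_n - Q_n R_n`, where each user uses the
bit-rate level that minimizes its own metric. -/
def subsetValue {N M : ℕ} (par : Params N M) (ν : Measure (Fin N → ℂ)) (V : ℝ) (Q : Fin N → ℝ)
    (Λ : Finset (Fin N)) : ℝ :=
  ∫ h, ⨅ n : Λ, ⨅ m : Fin M, (V * par.power n m (h n) - Q n * par.bitRate m) ∂ν

/-- `π` is a run of the proposed centralized algorithm with weight `V`, initial queues `Q₀` and
power quantizer `q`, ties being broken in any way: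
* phase 1: the feedback subset is optimal for `subsetValue` among all subsets of `K` users;
* phase 2: every reporting user `n` picks a level `ms n` that minimizes its metric (and reports
  the rate and the quantized power);
* phase 3: the user with the smallest reported metric is scheduled, at the level it picked. -/
def Policy.IsProposed {N M K : ℕ} {Ω : Type*} {H : ℕ → Ω → Fin N → ℂ} {𝓐 : MeasurableSpace Ω}
    (π : Policy M K H 𝓐) (par : Params N M) (ν : Measure (Fin N → ℂ)) (V : ℝ)
    (Q₀ : Ω → Fin N → ℝ) (q : ℝ → ℝ) : Prop :=
  ∀ t ω,
    ((π.feedback t ω).card = K ∧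
      ∀ Λ : Finset (Fin N), Λ.card = K →
        subsetValue par ν V (π.queue par Q₀ t ω) (π.feedback t ω) ≤
          subsetValue par ν V (π.queue par Q₀ t ω) Λ) ∧
    ∃ ms : Fin N → Fin M,
      (∀ n ∈ π.feedback t ω, ∀ m,
        V * par.power n (ms n) (H t ω n) - π.queue par Q₀ t ω n * par.bitRate (ms n) ≤
          V * par.power n m (H t ω n) - π.queue par Q₀ t ω n * par.bitRate m) ∧
      π.level t ω = ms (π.user t ω) ∧
      ∀ n ∈ π.feedback t ω,
        V * q (par.power (π.user t ω) (ms (π.user t ω)) (H t ω (π.user t ω)))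
            - π.queue par Q₀ t ω (π.user t ω) * par.bitRate (ms (π.user t ω)) ≤
          V * q (par.power n (ms n) (H t ω n)) - π.queue par Q₀ t ω n * par.bitRate (ms n)

end D2D

end

/-! Fix a nonnegative queue vector `Q`. In any slot the reporting set of a policy is independent of
the channels of that slot, so `V E[power] - ⟨Q, E[rate]⟩` is at least the smallest value `v(Q)` of
`subsetValue` over the sets of at most `K` users. Averaging over the slots of a feasible policy and
taking the infimum over these policies gives `v(Q) ≤ V P* - rth ∑ Q_n`, where `P*` is the optimal
power. The proposed algorithm attains `v(Q)` at the current queues `Q = Q(t)`, up to `2 δ V`: a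
quantization error enters once for the scheduled user and once for the user it is compared with.
Hence the drift of `E ∑ Q_n² / 2` plus `V` times the expected power is at most
`C + V P* + 2 δ V`.

Telescoping the drift bounds the average power from above. It also makes `E ∑ Q_n²` grow at most
linearly, so `E Q_n(T) / T → 0`, which forces the average rates up to `rth`: the algorithm is itself
feasible, hence its power is at least `P*`. -/

noncomputable section

namespace D2D

section Independence

variable {Ω : Type*} {m₀ : MeasurableSpace Ω} {μ : Measure Ω}

theorem generateFrom_image2_inter (m₁ m₂ : MeasurableSpace Ω) :
    MeasurableSpace.generateFrom (Set.image2 (· ∩ ·) {A | MeasurableSet[m₁] A}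
      {B | MeasurableSet[m₂] B}) = m₁ ⊔ m₂ := by
  refine le_antisymm (MeasurableSpace.generateFrom_le ?_) (sup_le (fun A hA => ?_) fun B hB => ?_)
  · rintro _ ⟨A, hA, B, hB, rfl⟩
    exact @MeasurableSet.inter _ (m₁ ⊔ m₂) _ _ (le_sup_left (a := m₁) _ hA)
      (le_sup_right (a := m₁) _ hB)
  · exact MeasurableSpace.measurableSet_generateFrom
      ⟨A, hA, Set.univ, @MeasurableSet.univ _ m₂, Set.inter_univ A⟩
  · exact MeasurableSpace.measurableSet_generateFrom
      ⟨Set.univ, @MeasurableSet.univ _ m₁, B, hB, Set.univ_inter B⟩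

theorem isPiSystem_image2_inter {S T : Set (Set Ω)} (hS : IsPiSystem S) (hT : IsPiSystem T) :
    IsPiSystem (Set.image2 (· ∩ ·) S T) := by
  rintro _ ⟨A, hA, B, hB, rfl⟩ _ ⟨A', hA', B', hB', rfl⟩ hne
  have hne' : ((A ∩ A') ∩ (B ∩ B')).Nonempty := by rwa [Set.inter_inter_inter_comm]
  exact ⟨A ∩ A', hS A hA A' hA' hne'.left, B ∩ B', hT B hB B' hB' hne'.right,
    Set.inter_inter_inter_comm A A' B B'⟩

theorem indep_sup_left [IsZeroOrProbabilityMeasure μ] {m m₁ m₂ : MeasurableSpace Ω} (hm : m ≤ m₀)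
    (h₁ : m₁ ≤ m₀) (h₂ : m₂ ≤ m₀) (h : Indep m (m₁ ⊔ m₂) μ) (h₁₂ : Indep m₁ m₂ μ) :
    Indep (m ⊔ m₁) m₂ μ := by
  refine IndepSets.indep (sup_le hm h₁) h₂
    (isPiSystem_image2_inter (@MeasurableSpace.isPiSystem_measurableSet _ m)
      (@MeasurableSpace.isPiSystem_measurableSet _ m₁))
    (@MeasurableSpace.isPiSystem_measurableSet _ m₂) (generateFrom_image2_inter m m₁).symm
    (@MeasurableSpace.generateFrom_measurableSet _ m₂).symm ?_
  rw [IndepSets_iff]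
  rw [Indep_iff] at h h₁₂
  rintro _ D ⟨A, hA, B, hB, rfl⟩ hD
  have hB' : MeasurableSet[m₁ ⊔ m₂] B := le_sup_left (a := m₁) _ hB
  have hD' : MeasurableSet[m₁ ⊔ m₂] D := le_sup_right (a := m₁) _ hD
  rw [Set.inter_assoc, h A (B ∩ D) hA (@MeasurableSet.inter _ (m₁ ⊔ m₂) _ _ hB' hD'),
    h₁₂ B D hB hD, h A B hA hB', mul_assoc]

variable [IsFiniteMeasure μ] {E F G : Type*} [MeasurableSpace E] [MeasurableSpace F]
  [NormedAddCommGroup G] {X : Ω → E} {Y : Ω → F} {f : F × E → G}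

theorem integrable_prod_map_of_indepFun (hY : AEMeasurable Y μ) (hX : AEMeasurable X μ)
    (hYX : IndepFun Y X μ) (hf : AEStronglyMeasurable f ((μ.map Y).prod (μ.map X)))
    (hint : Integrable (fun ω => f (Y ω, X ω)) μ) : Integrable f ((μ.map Y).prod (μ.map X)) := by
  rw [← hYX.map_prod_eq_prod_map_map hY hX] at hf ⊢
  exact (integrable_map_measure hf (hY.prodMk hX)).2 hint

variable [NormedSpace ℝ G]

theorem integrable_integral_of_indepFun (hY : AEMeasurable Y μ) (hX : AEMeasurable X μ)
    (hYX : IndepFun Y X μ) (hf : AEStronglyMeasurable f ((μ.map Y).prod (μ.map X)))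
    (hint : Integrable (fun ω => f (Y ω, X ω)) μ) :
    Integrable (fun ω => ∫ x, f (Y ω, x) ∂μ.map X) μ :=
  (integrable_prod_map_of_indepFun hY hX hYX hf hint).integral_prod_left.comp_aemeasurable hY

theorem integral_comp_of_indepFun (hY : AEMeasurable Y μ) (hX : AEMeasurable X μ)
    (hYX : IndepFun Y X μ) (hf : AEStronglyMeasurable f ((μ.map Y).prod (μ.map X)))
    (hint : Integrable (fun ω => f (Y ω, X ω)) μ) :
    ∫ ω, f (Y ω, X ω) ∂μ = ∫ ω, ∫ x, f (Y ω, x) ∂μ.map X ∂μ := by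
  have hprod := integrable_prod_map_of_indepFun hY hX hYX hf hint
  have hmap := hYX.map_prod_eq_prod_map_map hY hX
  calc ∫ ω, f (Y ω, X ω) ∂μ = ∫ z, f z ∂(μ.map Y).prod (μ.map X) := by
        rw [← hmap, integral_map (hY.prodMk hX) (hmap ▸ hf)]
    _ = ∫ y, ∫ x, f (y, x) ∂μ.map X ∂μ.map Y := integral_prod _ hprod
    _ = ∫ ω, ∫ x, f (Y ω, x) ∂μ.map X ∂μ :=
        integral_map hY hprod.integral_prod_left.aestronglyMeasurable

end Independence

section Metric

variable {N M : ℕ} (par : Params N M)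

theorem Params.power_mem_Icc (n : Fin N) (m : Fin M) (z : ℂ) :
    par.power n m z ∈ Set.Icc 0 par.pmax := by
  have hsnr := par.snr_nonneg m
  have hnoise := par.noise_pos.le
  have hloss := (par.pathLoss_pos n).le
  exact ⟨le_min (by positivity) par.pmax_pos.le, min_le_right _ _⟩

theorem Params.measurable_power (n : Fin N) (m : Fin M) : Measurable (par.power n m) := by
  unfold Params.power
  fun_prop

/-- The largest bit rate; it is `0` if there are no levels. -/
def Params.maxRate : ℝ := ⨆ m, par.bitRate m

theorem Params.bitRate_le_maxRate (m : Fin M) : par.bitRate m ≤ par.maxRate :=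
  le_ciSup (Set.finite_range par.bitRate).bddAbove m

theorem Params.maxRate_nonneg : 0 ≤ par.maxRate :=
  Real.iSup_nonneg par.bitRate_nonneg

theorem abs_metric_le {V : ℝ} (hV : 0 ≤ V) (Q : Fin N → ℝ) (n : Fin N) (m : Fin M) (z : ℂ) :
    |V * par.power n m z - Q n * par.bitRate m| ≤
      V * par.pmax + (∑ i, |Q i|) * par.maxRate := by
  have hpower := par.power_mem_Icc n m z
  have hrate := par.bitRate_nonneg m
  have hQ : |Q n| ≤ ∑ i, |Q i| :=
    Finset.single_le_sum (f := fun i => |Q i|) (fun i _ => abs_nonneg _) (Finset.mem_univ n)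
  calc |V * par.power n m z - Q n * par.bitRate m|
    _ ≤ |V * par.power n m z| + |Q n * par.bitRate m| := abs_sub _ _
    _ = V * par.power n m z + |Q n| * par.bitRate m := by
        rw [abs_of_nonneg (mul_nonneg hV hpower.1), abs_mul, abs_of_nonneg hrate]
    _ ≤ V * par.pmax + (∑ i, |Q i|) * par.maxRate := by
        gcongr
        exacts [hpower.2, par.bitRate_le_maxRate m]

/-- The smallest metric `V P_n - Q_n R_n` over the users in `Λ` and all levels when the channels
are `h`. It is the integrand of `subsetValue`, and the value that the algorithm attains, up to
quantization, once `Λ` has reported. -/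
def bestMetric (V : ℝ) (Q : Fin N → ℝ) (Λ : Finset (Fin N)) (h : Fin N → ℂ) : ℝ :=
  ⨅ n : Λ, ⨅ m : Fin M, (V * par.power n m (h n) - Q n * par.bitRate m)

variable (V : ℝ) (Q : Fin N → ℝ) {Λ Λ' : Finset (Fin N)} (h : Fin N → ℂ)

theorem bestMetric_le {n : Fin N} (hn : n ∈ Λ) (m : Fin M) :
    bestMetric par V Q Λ h ≤ V * par.power n m (h n) - Q n * par.bitRate m :=
  (ciInf_le (Set.finite_range _).bddBelow (⟨n, hn⟩ : Λ)).trans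
    (ciInf_le (Set.finite_range _).bddBelow m)

theorem measurable_bestMetric {α : Type*} [MeasurableSpace α] {Λ : α → Finset (Fin N)}
    {Q : α → Fin N → ℝ} {h : α → Fin N → ℂ} (hΛ : Measurable Λ) (hQ : Measurable Q)
    (hh : Measurable h) : Measurable fun a => bestMetric par V (Q a) (Λ a) (h a) := by
  have hfixed (Λ : Finset (Fin N)) : Measurable fun z : (Fin N → ℝ) × (Fin N → ℂ) =>
      bestMetric par V z.1 Λ z.2 := by
    refine Measurable.iInf fun n => Measurable.iInf fun m => ?_
    have hpower := par.measurable_power n m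
    fun_prop
  have hjoint : Measurable fun z : Finset (Fin N) × (Fin N → ℝ) × (Fin N → ℂ) =>
      bestMetric par V z.2.1 z.1 z.2.2 := measurable_from_prod_countable_right hfixed
  have hcomp := hjoint.comp (hΛ.prodMk (hQ.prodMk hh))
  exact hcomp

variable {V Q h} [Nonempty (Fin M)]

theorem le_bestMetric (hΛ : Λ.Nonempty) {c : ℝ}
    (hc : ∀ n ∈ Λ, ∀ m, c ≤ V * par.power n m (h n) - Q n * par.bitRate m) :
    c ≤ bestMetric par V Q Λ h := by
  have := hΛ.to_subtype
  exact le_ciInf fun n => le_ciInf fun m => hc n n.2 m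

theorem bestMetric_anti (hΛ : Λ.Nonempty) (hsub : Λ ⊆ Λ') :
    bestMetric par V Q Λ' h ≤ bestMetric par V Q Λ h :=
  le_bestMetric par hΛ fun _ hn m => bestMetric_le par V Q h (hsub hn) m

variable (Q h)

theorem abs_bestMetric_le (hV : 0 ≤ V) (Λ : Finset (Fin N)) :
    |bestMetric par V Q Λ h| ≤ V * par.pmax + (∑ i, |Q i|) * par.maxRate := by
  rcases Λ.eq_empty_or_nonempty with rfl | ⟨n, hn⟩
  · have := par.pmax_pos
    have := par.maxRate_nonneg
    rw [bestMetric, Real.iInf_of_isEmpty, abs_zero]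
    positivity
  · have m : Fin M := Classical.arbitrary _
    exact abs_le.2 ⟨le_bestMetric par ⟨n, hn⟩ fun n _ m =>
      (abs_le.1 (abs_metric_le par hV Q n m _)).1,
      (bestMetric_le par V Q h hn m).trans (abs_le.1 (abs_metric_le par hV Q n m _)).2⟩

variable (ν : Measure (Fin N → ℂ)) [IsFiniteMeasure ν]

theorem integrable_bestMetric (hV : 0 ≤ V) (Λ : Finset (Fin N)) :
    Integrable (bestMetric par V Q Λ) ν :=
  Integrable.of_bound (measurable_bestMetric par V measurable_const measurable_const
    measurable_id).aestronglyMeasurable _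
    (Eventually.of_forall fun h => abs_bestMetric_le par Q h hV Λ)

theorem subsetValue_anti (hV : 0 ≤ V) (hΛ : Λ.Nonempty) (hsub : Λ ⊆ Λ') :
    subsetValue par ν V Q Λ' ≤ subsetValue par ν V Q Λ :=
  integral_mono (integrable_bestMetric par Q ν hV Λ') (integrable_bestMetric par Q ν hV Λ)
    fun _ => bestMetric_anti par hΛ hsub

end Metric

section Information

variable {Ω E : Type*} [MeasurableSpace E]

/-- The prior information `𝓐` and all the channels of the slots before `t`, reported or not. -/
abbrev history (H : ℕ → Ω → E) (𝓐 : MeasurableSpace Ω) (t : ℕ) : MeasurableSpace Ω :=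
  𝓐 ⊔ ⨆ s ∈ Set.Iio t, MeasurableSpace.comap (H s) inferInstance

theorem history_mono {H : ℕ → Ω → E} {𝓐 : MeasurableSpace Ω} : Monotone (history H 𝓐) :=
  fun _ _ hst => sup_le_sup_left (biSup_mono fun _ hr => lt_of_lt_of_le hr hst) _

theorem measurable_history {H : ℕ → Ω → E} {𝓐 : MeasurableSpace Ω} {s t : ℕ} (hst : s < t) :
    Measurable[history H 𝓐 t] (H s) :=
  Measurable.of_comap_le (le_sup_of_le_right
    (le_biSup (fun s => MeasurableSpace.comap (H s) inferInstance) hst))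

theorem known_le_history {N : ℕ} {H : ℕ → Ω → Fin N → ℂ} {𝓐 : MeasurableSpace Ω}
    {Λ : ℕ → Ω → Finset (Fin N)}
    (hΛ : ∀ t (A : Finset (Fin N)), MeasurableSet[known H 𝓐 Λ t] {ω | Λ t ω = A}) (t : ℕ) :
    known H 𝓐 Λ t ≤ history H 𝓐 t := by
  induction t using Nat.strong_induction_on with
  | _ t ih =>
    refine sup_le le_sup_left (iSup_le fun s => Measurable.comap_le ?_)
    have hfeedback : Measurable[history H 𝓐 t] (Λ s) :=
      @measurable_to_countable' _ _ _ _ (history H 𝓐 t) _ fun A =>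
        history_mono s.2.le _ (ih s s.2 _ (hΛ s A))
    refine (@measurable_pi_iff _ _ _ (history H 𝓐 t) _ _).2 fun n => ?_
    exact Measurable.ite (hfeedback (MeasurableSet.of_discrete (s := {A | n ∈ A})))
      ((measurable_pi_apply n).comp (measurable_history s.2)) measurable_const

/-- The probabilistic assumptions of `IsFadingModel`, for observations of an arbitrary law `ν` in
an arbitrary space. If `ν` lets fading coefficients vanish with positive probability, then the
junk value `0` of `Params.power` occurs there; any other value in `[0, pmax]` would do. -/
structure IsIIDChannel (𝓐 : MeasurableSpace Ω) [mΩ : MeasurableSpace Ω] (μ : Measure Ω)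
    (ν : Measure E) (H : ℕ → Ω → E) : Prop where
  measurable : ∀ t, Measurable[mΩ] (H t)
  law : ∀ t, μ.map (H t) = ν
  iIndep : iIndepFun H μ
  prior_le : 𝓐 ≤ mΩ
  prior_indep : Indep 𝓐 (⨆ t, MeasurableSpace.comap (H t) inferInstance) μ

variable {𝓐 : MeasurableSpace Ω} [mΩ : MeasurableSpace Ω] {μ : Measure Ω}

theorem IsFadingModel.isIIDChannel {N : ℕ} {ν : Measure (Fin N → ℂ)} {H : ℕ → Ω → Fin N → ℂ}
    (hH : IsFadingModel 𝓐 μ ν H) : IsIIDChannel 𝓐 μ ν H :=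
  ⟨hH.measurable, hH.law, hH.iIndep, hH.prior_le, hH.prior_indep⟩

variable {ν : Measure E} {H : ℕ → Ω → E}

theorem IsIIDChannel.history_le (hH : IsIIDChannel 𝓐 μ ν H) (t : ℕ) : history H 𝓐 t ≤ mΩ :=
  sup_le hH.prior_le (iSup₂_le fun s _ => (hH.measurable s).comap_le)

theorem IsIIDChannel.isFiniteMeasure [IsFiniteMeasure μ] (hH : IsIIDChannel 𝓐 μ ν H) :
    IsFiniteMeasure ν :=
  hH.law 0 ▸ inferInstance

theorem IsIIDChannel.indep_history [IsProbabilityMeasure μ] (hH : IsIIDChannel 𝓐 μ ν H) (t : ℕ) :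
    Indep (history H 𝓐 t) (MeasurableSpace.comap (H t) inferInstance) μ := by
  have hpast : Indep (⨆ s ∈ Set.Iio t, MeasurableSpace.comap (H s) inferInstance)
      (MeasurableSpace.comap (H t) inferInstance) μ := by
    have hdisj : Disjoint (Set.Iio t) {t} := by simp
    simpa using indep_iSup_of_disjoint (fun s => (hH.measurable s).comap_le)
      ((iIndepFun_iff_iIndep ..).1 hH.iIndep) hdisj
  refine indep_sup_left hH.prior_le (iSup₂_le fun s _ => (hH.measurable s).comap_le)
    (hH.measurable t).comap_le (indep_of_indep_of_le_right hH.prior_indep ?_) hpast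
  exact sup_le (iSup₂_le fun s _ => le_iSup (fun t => MeasurableSpace.comap (H t) inferInstance) s)
    (le_iSup (fun t => MeasurableSpace.comap (H t) inferInstance) t)

theorem IsIIDChannel.indepFun_of_measurable_history [IsProbabilityMeasure μ]
    (hH : IsIIDChannel 𝓐 μ ν H) {F : Type*} [MeasurableSpace F] {Y : Ω → F} {t : ℕ}
    (hY : Measurable[history H 𝓐 t] Y) : IndepFun Y (H t) μ :=
  (IndepFun_iff_Indep ..).2 (indep_of_indep_of_le_left (hH.indep_history t) hY.comap_le)

end Information

section Policies

variable {N M K : ℕ} {Ω : Type*} {H : ℕ → Ω → Fin N → ℂ} {𝓐 : MeasurableSpace Ω}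

section Slot

variable (par : Params N M) (π : Policy M K H 𝓐)

theorem Policy.sum_txPower (t : ℕ) (ω : Ω) :
    ∑ n, π.txPower par t n ω = par.power (π.user t ω) (π.level t ω) (H t ω (π.user t ω)) := by
  simp [Policy.txPower]

theorem Policy.sum_mul_rate (Q : Fin N → ℝ) (t : ℕ) (ω : Ω) :
    ∑ n, Q n * π.rate par t n ω = Q (π.user t ω) * par.bitRate (π.level t ω) := by
  simp [Policy.rate]

theorem Policy.txPower_mem_Icc (t : ℕ) (n : Fin N) (ω : Ω) :
    π.txPower par t n ω ∈ Set.Icc 0 par.pmax := by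
  unfold Policy.txPower
  split_ifs
  exacts [par.power_mem_Icc _ _ _, Set.left_mem_Icc.2 par.pmax_pos.le]

theorem Policy.rate_mem_Icc (t : ℕ) (n : Fin N) (ω : Ω) :
    π.rate par t n ω ∈ Set.Icc 0 par.maxRate := by
  unfold Policy.rate
  split_ifs
  exacts [⟨par.bitRate_nonneg _, par.bitRate_le_maxRate _⟩, Set.left_mem_Icc.2 par.maxRate_nonneg]

theorem Policy.sum_secondMoment_mem_Icc (t : ℕ) (ω : Ω) :
    ∑ i, (par.rth ^ 2 + π.rate par t i ω ^ 2) / 2 ∈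
      Set.Icc 0 ((N * par.rth ^ 2 + par.maxRate ^ 2) / 2) := by
  refine ⟨Finset.sum_nonneg fun i _ => by positivity, ?_⟩
  have hlevel := pow_le_pow_left₀ (par.bitRate_nonneg _) (par.bitRate_le_maxRate (π.level t ω)) 2
  calc ∑ i, (par.rth ^ 2 + π.rate par t i ω ^ 2) / 2
    _ = (N * par.rth ^ 2 + par.bitRate (π.level t ω) ^ 2) / 2 := by
        simp [← Finset.sum_div, Finset.sum_add_distrib, Policy.rate, ite_pow]
    _ ≤ (N * par.rth ^ 2 + par.maxRate ^ 2) / 2 := by gcongr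

theorem Policy.measurable_feedback (t : ℕ) : Measurable[history H 𝓐 t] (π.feedback t) :=
  @measurable_to_countable' _ _ _ _ (history H 𝓐 t) _ fun A =>
    known_le_history π.feedback_measurable t _ (π.feedback_measurable t A)

theorem Policy.measurable_decision (t : ℕ) :
    Measurable[history H 𝓐 (t + 1)] fun ω => (π.user t ω, π.level t ω) := by
  refine @measurable_to_countable' _ _ _ _ (history H 𝓐 (t + 1)) _ fun ⟨n, m⟩ => ?_
  convert known_le_history π.feedback_measurable _ _ (π.decision_measurable t n m) using 1
  ext ω
  simp

theorem Policy.measurable_rate (t : ℕ) (n : Fin N) :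
    Measurable[history H 𝓐 (t + 1)] (π.rate par t n) :=
  (Measurable.of_discrete
    (f := fun d : Fin N × Fin M => if d.1 = n then par.bitRate d.2 else 0)).comp
    (π.measurable_decision t)

theorem Policy.measurable_txPower (t : ℕ) (n : Fin N) :
    Measurable[history H 𝓐 (t + 1)] (π.txPower par t n) := by
  have hpower : Measurable fun z : (Fin N × Fin M) × ℂ =>
      if z.1.1 = n then par.power n z.1.2 z.2 else 0 := by
    refine measurable_from_prod_countable_right fun d => ?_
    by_cases hd : d.1 = n
    · simpa only [hd, if_true] using par.measurable_power n d.2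
    · simpa only [hd, if_false] using measurable_const
  exact hpower.comp ((π.measurable_decision t).prodMk
    ((measurable_pi_apply n).comp (measurable_history t.lt_succ_self)))

end Slot

section Queue

variable (par : Params N M) (π : Policy M K H 𝓐) {Q₀ : Ω → Fin N → ℝ}

theorem Policy.measurable_queue (hQ₀ : Measurable[𝓐] Q₀) (t : ℕ) :
    Measurable[history H 𝓐 t] (π.queue par Q₀ t) := by
  induction t with
  | zero => exact hQ₀.mono le_sup_left le_rfl
  | succ t ih =>
    refine (@measurable_pi_iff _ _ _ (history H 𝓐 (t + 1)) _ _).2 fun n => ?_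
    have hqueue : Measurable[history H 𝓐 (t + 1)] fun ω => π.queue par Q₀ t ω n :=
      (measurable_pi_apply n).comp (ih.mono (history_mono t.le_succ) le_rfl)
    exact ((hqueue.sub (π.measurable_rate par t n)).max measurable_const).add measurable_const

theorem Policy.queue_nonneg (hQ₀ : ∀ ω n, 0 ≤ Q₀ ω n) (t : ℕ) (ω : Ω) (n : Fin N) :
    0 ≤ π.queue par Q₀ t ω n := by
  cases t with
  | zero => exact hQ₀ ω n
  | succ t => exact add_nonneg (le_max_right _ _) par.rth_nonneg

theorem Policy.queue_sub_rate_add_rth_le (t : ℕ) (ω : Ω) (n : Fin N) :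
    π.queue par Q₀ t ω n - π.rate par t n ω + par.rth ≤ π.queue par Q₀ (t + 1) ω n :=
  add_le_add_left (le_max_left _ _) _

theorem sq_max_sub_add_le {Q R r : ℝ} (hQ : 0 ≤ Q) (hR : 0 ≤ R) (hr : 0 ≤ r) :
    (max (Q - R) 0 + r) ^ 2 / 2 ≤ Q ^ 2 / 2 + (r ^ 2 + R ^ 2) / 2 + r * Q - Q * R := by
  have hmax : max (Q - R) 0 ≤ Q := max_le (sub_le_self _ hR) hQ
  have hsq : max (Q - R) 0 ^ 2 ≤ (Q - R) ^ 2 :=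
    sq_le_sq.2 (by simpa using abs_max_le_max_abs_abs (a := Q - R) (b := 0))
  linarith [mul_le_mul_of_nonneg_left hmax hr, add_sq (max (Q - R) 0) r, sub_sq Q R]

theorem Policy.sum_queue_succ_sq_le (hQ₀ : ∀ ω n, 0 ≤ Q₀ ω n) (t : ℕ) (ω : Ω) :
    ∑ n, π.queue par Q₀ (t + 1) ω n ^ 2 / 2 ≤
      ∑ n, π.queue par Q₀ t ω n ^ 2 / 2 + ∑ n, (par.rth ^ 2 + π.rate par t n ω ^ 2) / 2 +
        par.rth * ∑ n, π.queue par Q₀ t ω n -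
        ∑ n, π.queue par Q₀ t ω n * π.rate par t n ω := by
  rw [Finset.mul_sum, ← Finset.sum_add_distrib, ← Finset.sum_add_distrib,
    ← Finset.sum_sub_distrib]
  exact Finset.sum_le_sum fun n _ => sq_max_sub_add_le (π.queue_nonneg par hQ₀ t ω n)
    (π.rate_mem_Icc par t n ω).1 par.rth_nonneg

end Queue

section Integrability

variable {par : Params N M} {π : Policy M K H 𝓐} [mΩ : MeasurableSpace Ω] {μ : Measure Ω}
  {ν : Measure (Fin N → ℂ)} {Q₀ : Ω → Fin N → ℝ}

/-- The assumptions on the initial queues: they are nonnegative, square integrable and part of the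
prior information `𝓐`. -/
structure IsInitialQueue (𝓐 : MeasurableSpace Ω) [MeasurableSpace Ω] (μ : Measure Ω)
    (Q₀ : Ω → Fin N → ℝ) : Prop where
  measurable : Measurable[𝓐] Q₀
  nonneg : ∀ ω n, 0 ≤ Q₀ ω n
  integrable_sq : ∀ n, Integrable (fun ω => Q₀ ω n ^ 2) μ

theorem IsInitialQueue.measurable_queue (hQ₀ : IsInitialQueue 𝓐 μ Q₀)
    (hH : IsIIDChannel 𝓐 μ ν H) (t : ℕ) : Measurable (π.queue par Q₀ t) :=
  (π.measurable_queue par hQ₀.measurable t).mono (hH.history_le t) le_rfl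

variable [IsFiniteMeasure μ]

theorem Policy.memLp_rate (hH : IsIIDChannel 𝓐 μ ν H) (t : ℕ) (n : Fin N) (p : ENNReal) :
    MemLp (π.rate par t n) p μ :=
  memLp_of_bounded (Eventually.of_forall (π.rate_mem_Icc par t n))
    ((π.measurable_rate par t n).mono (hH.history_le _) le_rfl).aestronglyMeasurable p

theorem Policy.integrable_rate (hH : IsIIDChannel 𝓐 μ ν H) (t : ℕ) (n : Fin N) :
    Integrable (π.rate par t n) μ :=
  memLp_one_iff_integrable.1 (Policy.memLp_rate hH t n 1)

theorem Policy.integrable_sum_secondMoment (hH : IsIIDChannel 𝓐 μ ν H) (t : ℕ) :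
    Integrable (fun ω => ∑ i, (par.rth ^ 2 + π.rate par t i ω ^ 2) / 2) μ :=
  integrable_finsetSum _ fun i _ =>
    ((integrable_const _).add (Policy.memLp_rate hH t i 2).integrable_sq).div_const 2

theorem Policy.integrable_txPower (hH : IsIIDChannel 𝓐 μ ν H) (t : ℕ) (n : Fin N) :
    Integrable (π.txPower par t n) μ :=
  Integrable.of_mem_Icc 0 par.pmax
    ((π.measurable_txPower par t n).mono (hH.history_le _) le_rfl).aemeasurable
    (Eventually.of_forall (π.txPower_mem_Icc par t n))

theorem IsInitialQueue.memLp_queue (hQ₀ : IsInitialQueue 𝓐 μ Q₀) (hH : IsIIDChannel 𝓐 μ ν H)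
    (t : ℕ) (n : Fin N) : MemLp (fun ω => π.queue par Q₀ t ω n) 2 μ := by
  induction t with
  | zero =>
    have hmeas : Measurable fun ω => Q₀ ω n :=
      (measurable_pi_apply n).comp (hQ₀.measurable.mono hH.prior_le le_rfl)
    exact (memLp_two_iff_integrable_sq hmeas.aestronglyMeasurable).2 (hQ₀.integrable_sq n)
  | succ t ih => exact (ih.sub (Policy.memLp_rate hH t n 2)).pos_part.add (memLp_const _)

theorem IsInitialQueue.integrable_queue (hQ₀ : IsInitialQueue 𝓐 μ Q₀)
    (hH : IsIIDChannel 𝓐 μ ν H) (t : ℕ) (n : Fin N) :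
    Integrable (fun ω => π.queue par Q₀ t ω n) μ :=
  (hQ₀.memLp_queue hH t n).integrable one_le_two

theorem IsInitialQueue.integrable_sum_queue_sq (hQ₀ : IsInitialQueue 𝓐 μ Q₀)
    (hH : IsIIDChannel 𝓐 μ ν H) (t : ℕ) :
    Integrable (fun ω => ∑ n, π.queue par Q₀ t ω n ^ 2 / 2) μ :=
  integrable_finsetSum _ fun n _ => (hQ₀.memLp_queue hH t n).integrable_sq.div_const 2

theorem Policy.integrable_sum_mul_rate (hH : IsIIDChannel 𝓐 μ ν H) {Q : Ω → Fin N → ℝ}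
    (hQ : ∀ n, Integrable (fun ω => Q ω n) μ) (t : ℕ) :
    Integrable (fun ω => ∑ n, Q ω n * π.rate par t n ω) μ :=
  integrable_finsetSum _ fun n _ => (hQ n).mul_bdd (c := par.maxRate)
    (Policy.integrable_rate hH t n).aestronglyMeasurable (Eventually.of_forall fun ω => by
      rw [Real.norm_of_nonneg (π.rate_mem_Icc par t n ω).1]
      exact (π.rate_mem_Icc par t n ω).2)

end Integrability

section MeanPower

variable (par : Params N M) (π : Policy M K H 𝓐) [MeasurableSpace Ω] (μ : Measure Ω)

/-- The expected total power of slot `t`; `Policy.limsupPower` is the limsup of its averages. -/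
def Policy.meanPower (t : ℕ) : ℝ := ∑ n, ∫ ω, π.txPower par t n ω ∂μ

variable {par π μ} {ν : Measure (Fin N → ℂ)} (hH : IsIIDChannel 𝓐 μ ν H) (t : ℕ)
include hH

theorem Policy.meanPower_eq_integral [IsFiniteMeasure μ] :
    π.meanPower par μ t = ∫ ω, ∑ n, π.txPower par t n ω ∂μ :=
  (integral_finsetSum _ fun n _ => Policy.integrable_txPower hH t n).symm

variable [IsProbabilityMeasure μ]

theorem Policy.meanPower_mem_Icc : π.meanPower par μ t ∈ Set.Icc 0 par.pmax := by
  rw [Policy.meanPower_eq_integral hH]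
  refine (convex_Icc 0 par.pmax).integral_mem isClosed_Icc (Eventually.of_forall fun ω => ?_)
    (integrable_finsetSum _ fun n _ => Policy.integrable_txPower hH t n)
  rw [π.sum_txPower]
  exact par.power_mem_Icc _ _ _

theorem Policy.integral_rate_mem_Icc (n : Fin N) :
    ∫ ω, π.rate par t n ω ∂μ ∈ Set.Icc 0 par.maxRate :=
  (convex_Icc 0 par.maxRate).integral_mem isClosed_Icc
    (Eventually.of_forall (π.rate_mem_Icc par t n)) (Policy.integrable_rate hH t n)

end MeanPower

section Freezing

variable {par : Params N M} {π : Policy M K H 𝓐} [mΩ : MeasurableSpace Ω] {μ : Measure Ω}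
  [IsProbabilityMeasure μ] {ν : Measure (Fin N → ℂ)} {V : ℝ} {Q : Ω → Fin N → ℝ} {t : ℕ}

theorem Policy.nonempty_level (μ : Measure Ω) [IsProbabilityMeasure μ] (π : Policy M K H 𝓐) :
    Nonempty (Fin M) :=
  let ⟨ω⟩ := nonempty_of_isProbabilityMeasure μ
  ⟨π.level 0 ω⟩

theorem Policy.integrable_bestMetric (hH : IsIIDChannel 𝓐 μ ν H) (hV : 0 ≤ V)
    (hQ : Measurable Q) (hQi : ∀ n, Integrable (fun ω => Q ω n) μ) :
    Integrable (fun ω => bestMetric par V (Q ω) (π.feedback t ω) (H t ω)) μ := by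
  have := π.nonempty_level μ
  have hfeedback : Measurable (π.feedback t) :=
    (π.measurable_feedback t).mono (hH.history_le t) le_rfl
  have hbound : Integrable (fun ω => V * par.pmax + (∑ n, |Q ω n|) * par.maxRate) μ :=
    (integrable_const _).add ((integrable_finsetSum _ fun n _ => (hQi n).abs).mul_const _)
  exact hbound.mono'
    (measurable_bestMetric par V hfeedback hQ (hH.measurable t)).aestronglyMeasurable
    (Eventually.of_forall fun ω => abs_bestMetric_le par (Q ω) (H t ω) hV (π.feedback t ω))

variable (hH : IsIIDChannel 𝓐 μ ν H) (hV : 0 ≤ V) (hQ : Measurable[history H 𝓐 t] Q)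
  (hQi : ∀ n, Integrable (fun ω => Q ω n) μ)
include hH hV hQ hQi

theorem Policy.integrable_subsetValue :
    Integrable (fun ω => subsetValue par ν V (Q ω) (π.feedback t ω)) μ := by
  have hknown := (π.measurable_feedback t).prodMk hQ
  have hbest := measurable_bestMetric (α := (Finset (Fin N) × (Fin N → ℝ)) × (Fin N → ℂ)) par V
    (Λ := fun z => z.1.1) (Q := fun z => z.1.2) (h := fun z => z.2)
    (by fun_prop) (by fun_prop) (by fun_prop)
  have hfreeze := integrable_integral_of_indepFun
    (hknown.mono (hH.history_le t) le_rfl).aemeasurable (hH.measurable t).aemeasurable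
    (hH.indepFun_of_measurable_history hknown) hbest.aestronglyMeasurable
    (Policy.integrable_bestMetric hH hV (hQ.mono (hH.history_le t) le_rfl) hQi)
  rwa [hH.law t] at hfreeze

theorem Policy.integral_subsetValue_eq :
    ∫ ω, subsetValue par ν V (Q ω) (π.feedback t ω) ∂μ =
      ∫ ω, bestMetric par V (Q ω) (π.feedback t ω) (H t ω) ∂μ := by
  have hknown := (π.measurable_feedback t).prodMk hQ
  have hbest := measurable_bestMetric (α := (Finset (Fin N) × (Fin N → ℝ)) × (Fin N → ℂ)) par V
    (Λ := fun z => z.1.1) (Q := fun z => z.1.2) (h := fun z => z.2)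
    (by fun_prop) (by fun_prop) (by fun_prop)
  have hfreeze := integral_comp_of_indepFun
    (hknown.mono (hH.history_le t) le_rfl).aemeasurable (hH.measurable t).aemeasurable
    (hH.indepFun_of_measurable_history hknown) hbest.aestronglyMeasurable
    (Policy.integrable_bestMetric hH hV (hQ.mono (hH.history_le t) le_rfl) hQi)
  rw [hH.law t] at hfreeze
  exact hfreeze.symm

end Freezing

end Policies

section Averages

/-- The average of `u` over the slots `1, …, T`, as in `Policy.limsupPower` and `Policy.Feasible`;
it is `0` for `T = 0`. -/
def average (u : ℕ → ℝ) (T : ℕ) : ℝ := (1 / (T : ℝ)) * ∑ t ∈ Finset.Icc 1 T, u t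

theorem average_mono {u v : ℕ → ℝ} (h : ∀ t, u t ≤ v t) (T : ℕ) : average u T ≤ average v T :=
  mul_le_mul_of_nonneg_left (Finset.sum_le_sum fun t _ => h t) (by positivity)

theorem average_const {T : ℕ} (hT : T ≠ 0) (c : ℝ) : average (fun _ => c) T = c := by
  simp [average, hT]

theorem average_mul_sub_sum {ι : Type*} [Fintype ι] (V : ℝ) (Q : ι → ℝ) (p : ℕ → ℝ)
    (r : ι → ℕ → ℝ) (T : ℕ) :
    average (fun t => V * p t - ∑ n, Q n * r n t) T =
      V * average p T - ∑ n, Q n * average (r n) T := by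
  simp only [average, Finset.sum_sub_distrib, mul_sub, ← Finset.mul_sum]
  rw [Finset.sum_comm, mul_left_comm]
  simp only [mul_left_comm (Q _) (1 / (T : ℝ)), ← Finset.mul_sum]

variable {u : ℕ → ℝ} {a b : ℝ}

theorem average_mem_Icc (hu : ∀ t, u t ∈ Set.Icc a b) {T : ℕ} (hT : T ≠ 0) :
    average u T ∈ Set.Icc a b :=
  ⟨(average_const hT a).ge.trans (average_mono (fun t => (hu t).1) T),
    (average_mono (fun t => (hu t).2) T).trans (average_const hT b).le⟩

theorem isBoundedUnder_le_average (hu : ∀ t, u t ∈ Set.Icc a b) :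
    IsBoundedUnder (· ≤ ·) atTop (average u) :=
  isBoundedUnder_of_eventually_le
    ((eventually_ne_atTop 0).mono fun _ hT => (average_mem_Icc hu hT).2)

theorem isBoundedUnder_ge_average (hu : ∀ t, u t ∈ Set.Icc a b) :
    IsBoundedUnder (· ≥ ·) atTop (average u) :=
  isBoundedUnder_of_eventually_ge
    ((eventually_ne_atTop 0).mono fun _ hT => (average_mem_Icc hu hT).1)

theorem le_limsup_average (hu : ∀ t, u t ∈ Set.Icc a b) : a ≤ limsup (average u) atTop :=
  le_limsup_of_frequently_le
    ((eventually_ne_atTop 0).mono fun _ hT => (average_mem_Icc hu hT).1).frequently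
    (isBoundedUnder_le_average hu)

section Drift

variable {L : ℕ → ℝ} {B : ℝ} (h : ∀ t, L (t + 1) + u t ≤ L t + B)
include h

theorem average_le_of_drift {T : ℕ} (hT : T ≠ 0) :
    average u T ≤ B + (L 1 - L (T + 1)) / T := by
  have htelescope : ∑ t ∈ Finset.Icc 1 T, (L (t + 1) - L t) = L (T + 1) - L 1 :=
    Finset.sum_Ico_sub L (by lia)
  have hsum : ∑ t ∈ Finset.Icc 1 T, u t ≤ ∑ t ∈ Finset.Icc 1 T, (B - (L (t + 1) - L t)) :=
    Finset.sum_le_sum fun t _ => by linarith [h t]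
  rw [Finset.sum_sub_distrib, htelescope, Finset.sum_const, Nat.card_Icc, nsmul_eq_mul,
    Nat.add_sub_cancel] at hsum
  calc average u T ≤ 1 / (T : ℝ) * (T * B - (L (T + 1) - L 1)) :=
        mul_le_mul_of_nonneg_left hsum (by positivity)
    _ = B + (L 1 - L (T + 1)) / T := by field_simp; ring

theorem limsup_average_le_of_drift (hu : ∀ t, u t ∈ Set.Icc a b) (hL : ∀ t, 0 ≤ L t) :
    limsup (average u) atTop ≤ B := by
  have hlim : Tendsto (fun T : ℕ => B + L 1 / T) atTop (nhds B) := by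
    simpa using tendsto_const_nhds.add (tendsto_const_div_atTop_nhds_zero_nat (L 1))
  rw [← hlim.limsup_eq]
  refine limsup_le_limsup ((eventually_ne_atTop 0).mono fun T hT => ?_)
    (isBoundedUnder_ge_average hu).isCoboundedUnder_le hlim.isBoundedUnder_le
  calc average u T ≤ B + (L 1 - L (T + 1)) / T := average_le_of_drift h hT
    _ ≤ B + L 1 / T := by
        gcongr
        exact sub_le_self _ (hL _)

theorem le_add_mul_of_drift (hu : ∀ t, 0 ≤ u t) (t : ℕ) : L t ≤ L 0 + B * t := by
  induction t with
  | zero => simp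
  | succ t ih =>
    push_cast
    linarith [h t, hu t]

end Drift

theorem tendsto_div_atTop_of_sq_le_linear {x : ℕ → ℝ} {A B : ℝ} (h : ∀ t, x t ^ 2 ≤ A + B * t) :
    Tendsto (fun t : ℕ => x t / t) atTop (nhds 0) := by
  have hlim : Tendsto (fun t : ℕ => (A / t + B) * (1 / t)) atTop (nhds 0) := by
    simpa using ((tendsto_const_div_atTop_nhds_zero_nat A).add_const B).mul
      (tendsto_const_div_atTop_nhds_zero_nat 1)
  have hsq : Tendsto (fun t : ℕ => (x t / t) ^ 2) atTop (nhds 0) := by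
    refine squeeze_zero' (Eventually.of_forall fun t => sq_nonneg _)
      ((eventually_ne_atTop 0).mono fun t ht => ?_) hlim
    calc (x t / t) ^ 2 ≤ (A + B * t) / t ^ 2 := by rw [div_pow]; gcongr; exact h t
      _ = (A / t + B) * (1 / t) := by field_simp
  simpa [Real.sqrt_sq_eq_abs, tendsto_zero_iff_abs_tendsto_zero, Function.comp_def] using hsq.sqrt

theorem le_liminf_average_of_tendsto {Q r : ℕ → ℝ} {ρ : ℝ} (hr : ∀ t, r t ∈ Set.Icc a b)
    (h : ∀ t, Q t - r t + ρ ≤ Q (t + 1))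
    (hQ : Tendsto (fun T : ℕ => Q (T + 1) / T) atTop (nhds 0)) :
    ρ ≤ liminf (average r) atTop := by
  have hlim : Tendsto (fun T : ℕ => ρ + Q 1 / T - Q (T + 1) / T) atTop (nhds ρ) := by
    simpa using (tendsto_const_nhds.add (tendsto_const_div_atTop_nhds_zero_nat (Q 1))).sub hQ
  rw [← hlim.liminf_eq]
  refine liminf_le_liminf ((eventually_ne_atTop 0).mono fun T hT => ?_) hlim.isBoundedUnder_ge
    (isBoundedUnder_le_average hr).isCoboundedUnder_ge
  have hneg : average (fun t => -r t) T = -average r T := by simp [average]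
  have hdrift := average_le_of_drift (L := fun t => -Q t) (u := fun t => -r t) (B := -ρ)
    (fun t => by linarith [h t]) hT
  rw [hneg, sub_div, neg_div, neg_div] at hdrift
  linarith

theorem le_mul_limsup_average_sub {ι : Type*} [Fintype ι] {V c ρ a' b' : ℝ} {Q : ι → ℝ}
    {p : ℕ → ℝ} {r : ι → ℕ → ℝ} (hV : 0 ≤ V) (hQ : ∀ n, 0 ≤ Q n)
    (hp : ∀ t, p t ∈ Set.Icc a b) (hr : ∀ n t, r n t ∈ Set.Icc a' b')
    (hρ : ∀ n, ρ ≤ liminf (average (r n)) atTop)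
    (hslot : ∀ t, c ≤ V * p t - ∑ n, Q n * r n t) :
    c ≤ V * limsup (average p) atTop - ρ * ∑ n, Q n := by
  have hslack (ε : ℝ) (hε : 0 < ε) :
      c ≤ V * (limsup (average p) atTop + ε) - (ρ - ε) * ∑ n, Q n := by
    have hpower : ∀ᶠ T in atTop, average p T < limsup (average p) atTop + ε :=
      eventually_lt_of_limsup_lt (lt_add_of_pos_right _ hε) (isBoundedUnder_le_average hp)
    have hrate : ∀ᶠ T in atTop, ∀ n, ρ - ε < average (r n) T :=
      eventually_all.2 fun n => eventually_lt_of_lt_liminf ((sub_lt_self _ hε).trans_le (hρ n))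
        (isBoundedUnder_ge_average (hr n))
    obtain ⟨T, hpowerT, hrateT, hT⟩ := (hpower.and (hrate.and (eventually_ne_atTop 0))).exists
    calc c = average (fun _ => c) T := (average_const hT c).symm
      _ ≤ V * average p T - ∑ n, Q n * average (r n) T :=
        (average_mono hslot T).trans_eq (average_mul_sub_sum V Q p r T)
      _ ≤ V * (limsup (average p) atTop + ε) - (ρ - ε) * ∑ n, Q n := by
        rw [mul_comm (ρ - ε), Finset.sum_mul]
        gcongr with n
        exacts [hQ n, (hrateT n).le]
  have hcont : Continuous fun ε => V * (limsup (average p) atTop + ε) - (ρ - ε) * ∑ n, Q n := by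
    fun_prop
  have hlim := (hcont.continuousWithinAt (s := Set.Ioi 0) (x := 0)).tendsto
  simpa using ge_of_tendsto hlim (eventually_nhdsWithin_of_forall hslack)

end Averages

section Duality

variable {N M K : ℕ} {Ω : Type*} {H : ℕ → Ω → Fin N → ℂ} {𝓐 : MeasurableSpace Ω}
  {par : Params N M} {π : Policy M K H 𝓐} [mΩ : MeasurableSpace Ω] {μ : Measure Ω}
  [IsProbabilityMeasure μ] {ν : Measure (Fin N → ℂ)} {V c : ℝ}

section Slot

variable (hH : IsIIDChannel 𝓐 μ ν H) {Q : Ω → Fin N → ℝ} {t : ℕ}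
  (hQi : ∀ n, Integrable (fun ω => Q ω n) μ)
include hH hQi

theorem Policy.integrable_mul_sum_txPower_sub :
    Integrable (fun ω => V * ∑ n, π.txPower par t n ω - ∑ n, Q ω n * π.rate par t n ω) μ :=
  ((integrable_finsetSum _ fun n _ => Policy.integrable_txPower hH t n).const_mul V).sub
    (Policy.integrable_sum_mul_rate hH hQi t)

theorem Policy.integral_mul_sum_txPower_sub :
    ∫ ω, (V * ∑ n, π.txPower par t n ω - ∑ n, Q ω n * π.rate par t n ω) ∂μ =
      V * π.meanPower par μ t - ∫ ω, ∑ n, Q ω n * π.rate par t n ω ∂μ := by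
  rw [integral_sub
    ((integrable_finsetSum _ fun n _ => Policy.integrable_txPower hH t n).const_mul V)
    (Policy.integrable_sum_mul_rate hH hQi t), integral_const_mul,
    Policy.meanPower_eq_integral hH]

theorem Policy.integral_subsetValue_le (hV : 0 ≤ V) (hQ : Measurable[history H 𝓐 t] Q) :
    ∫ ω, subsetValue par ν V (Q ω) (π.feedback t ω) ∂μ ≤
      V * π.meanPower par μ t - ∫ ω, ∑ n, Q ω n * π.rate par t n ω ∂μ := by
  rw [Policy.integral_subsetValue_eq hH hV hQ hQi,
    ← Policy.integral_mul_sum_txPower_sub hH hQi]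
  refine integral_mono (Policy.integrable_bestMetric hH hV (hQ.mono (hH.history_le t) le_rfl) hQi)
    (Policy.integrable_mul_sum_txPower_sub hH hQi) fun ω => ?_
  simp only [π.sum_txPower, π.sum_mul_rate]
  exact bestMetric_le par V (Q ω) (H t ω) (π.user_mem t ω) _

end Slot

variable (hH : IsIIDChannel 𝓐 μ ν H)
include hH

theorem Policy.limsupPower_nonneg : 0 ≤ π.limsupPower par μ :=
  le_limsup_average fun t => Policy.meanPower_mem_Icc hH t

theorem Policy.Feasible.optimalPower_le (hπ : π.Feasible par μ) :
    optimalPower 𝓐 par K μ H ≤ π.limsupPower par μ :=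
  csInf_le ⟨0, by rintro _ ⟨π', -, rfl⟩; exact Policy.limsupPower_nonneg hH⟩ ⟨π, hπ, rfl⟩

variable {Q : Fin N → ℝ}
  (hc : ∀ Λ : Finset (Fin N), Λ.Nonempty → Λ.card ≤ K → c ≤ subsetValue par ν V Q Λ)
include hc

theorem Policy.le_mul_meanPower_sub (hV : 0 ≤ V) (t : ℕ) :
    c ≤ V * π.meanPower par μ t - ∑ n, Q n * ∫ ω, π.rate par t n ω ∂μ := by
  have hQi (n : Fin N) : Integrable (fun _ : Ω => Q n) μ := integrable_const _
  calc c = ∫ _, c ∂μ := by simp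
    _ ≤ ∫ ω, subsetValue par ν V Q (π.feedback t ω) ∂μ :=
        integral_mono (integrable_const c)
          (Policy.integrable_subsetValue hH hV measurable_const hQi)
          fun ω => hc _ ⟨_, π.user_mem t ω⟩ (π.card_feedback_le t ω)
    _ ≤ V * π.meanPower par μ t - ∫ ω, ∑ n, Q n * π.rate par t n ω ∂μ :=
        Policy.integral_subsetValue_le hH hQi hV measurable_const
    _ = V * π.meanPower par μ t - ∑ n, Q n * ∫ ω, π.rate par t n ω ∂μ := by
        rw [integral_finsetSum _ fun n _ => (Policy.integrable_rate hH t n).const_mul _]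
        simp only [integral_const_mul]

variable (hQ : ∀ n, 0 ≤ Q n)
include hQ

theorem Policy.Feasible.le_mul_limsupPower_sub (hπ : π.Feasible par μ) (hV : 0 ≤ V) :
    c ≤ V * π.limsupPower par μ - par.rth * ∑ n, Q n :=
  le_mul_limsup_average_sub hV hQ (fun t => Policy.meanPower_mem_Icc hH t)
    (fun n t => Policy.integral_rate_mem_Icc hH t n) hπ (Policy.le_mul_meanPower_sub hH hc hV)

theorem le_mul_optimalPower_sub (hV : 0 < V) (hfeas : ∃ π : Policy M K H 𝓐, π.Feasible par μ) :
    c ≤ V * optimalPower 𝓐 par K μ H - par.rth * ∑ n, Q n := by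
  obtain ⟨π₀, hπ₀⟩ := hfeas
  have hbound : (c + par.rth * ∑ n, Q n) / V ≤ optimalPower 𝓐 par K μ H := by
    refine le_csInf ⟨_, π₀, hπ₀, rfl⟩ ?_
    rintro _ ⟨π, hπ, rfl⟩
    rw [div_le_iff₀' hV, ← le_sub_iff_add_le]
    exact hπ.le_mul_limsupPower_sub hH hc hQ hV.le
  rwa [div_le_iff₀' hV, ← le_sub_iff_add_le] at hbound

end Duality

section Lyapunov

variable {N M K : ℕ} {Ω : Type*} {H : ℕ → Ω → Fin N → ℂ} {𝓐 : MeasurableSpace Ω}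

/-- The expected quadratic Lyapunov function `E ∑ Q_n(t)² / 2` of the virtual queues. -/
def Policy.lyapunov (par : Params N M) (π : Policy M K H 𝓐) (Q₀ : Ω → Fin N → ℝ)
    [MeasurableSpace Ω] (μ : Measure Ω) (t : ℕ) : ℝ :=
  ∫ ω, ∑ n, π.queue par Q₀ t ω n ^ 2 / 2 ∂μ

variable {par : Params N M} {π : Policy M K H 𝓐} [mΩ : MeasurableSpace Ω] {μ : Measure Ω}
  {ν : Measure (Fin N → ℂ)} {Q₀ : Ω → Fin N → ℝ} {C : ℝ}

theorem Policy.lyapunov_nonneg (t : ℕ) : 0 ≤ π.lyapunov par Q₀ μ t :=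
  integral_nonneg fun _ => Finset.sum_nonneg fun _ _ => by positivity

variable [IsProbabilityMeasure μ] (hH : IsIIDChannel 𝓐 μ ν H) (hQ₀ : IsInitialQueue 𝓐 μ Q₀)
include hH hQ₀

theorem Policy.isDriftConstant :
    π.IsDriftConstant par μ Q₀ ((N * par.rth ^ 2 + par.maxRate ^ 2) / 2) := by
  intro t
  have hmono := condExp_mono (m := MeasurableSpace.comap (π.queue par Q₀ t) inferInstance)
    (Policy.integrable_sum_secondMoment hH t) (integrable_const (μ := μ) _)
    (Eventually.of_forall fun ω => (π.sum_secondMoment_mem_Icc par t ω).2)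
  rwa [condExp_const (hQ₀.measurable_queue hH t).comap_le] at hmono

theorem Policy.IsDriftConstant.integral_le (hC : π.IsDriftConstant par μ Q₀ C) (t : ℕ) :
    ∫ ω, ∑ i, (par.rth ^ 2 + π.rate par t i ω ^ 2) / 2 ∂μ ≤ C := by
  rw [← integral_condExp (hQ₀.measurable_queue (par := par) (π := π) hH t).comap_le]
  simpa using integral_mono_ae integrable_condExp (integrable_const C) (hC t)

theorem Policy.IsDriftConstant.lyapunov_succ_le (hC : π.IsDriftConstant par μ Q₀ C) (t : ℕ) :
    π.lyapunov par Q₀ μ (t + 1) ≤ π.lyapunov par Q₀ μ t + C +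
      par.rth * ∫ ω, ∑ n, π.queue par Q₀ t ω n ∂μ -
      ∫ ω, ∑ n, π.queue par Q₀ t ω n * π.rate par t n ω ∂μ := by
  have hsq := hQ₀.integrable_sum_queue_sq (par := par) (π := π) hH
  have hmoment := Policy.integrable_sum_secondMoment (par := par) (π := π) hH t
  have hqueue : Integrable (fun ω => par.rth * ∑ n, π.queue par Q₀ t ω n) μ :=
    (integrable_finsetSum _ fun n _ => hQ₀.integrable_queue hH t n).const_mul _
  have hservice := Policy.integrable_sum_mul_rate (par := par) (π := π) hH
    (hQ₀.integrable_queue (par := par) (π := π) hH t) t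
  have hdrift := integral_mono (hsq (t + 1)) ((((hsq t).add hmoment).add hqueue).sub hservice)
    (π.sum_queue_succ_sq_le par hQ₀.nonneg t)
  rw [integral_sub' (((hsq t).add hmoment).add hqueue) hservice,
    integral_add' ((hsq t).add hmoment) hqueue, integral_add' (hsq t) hmoment,
    integral_const_mul] at hdrift
  have hsecond := hC.integral_le hH hQ₀ t
  simp only [Policy.lyapunov]
  linarith

theorem Policy.sq_integral_queue_le (t : ℕ) (n : Fin N) :
    (∫ ω, π.queue par Q₀ t ω n ∂μ) ^ 2 ≤ 2 * π.lyapunov par Q₀ μ t := by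
  have hqueue := hQ₀.memLp_queue (par := par) (π := π) hH t n
  calc (∫ ω, π.queue par Q₀ t ω n ∂μ) ^ 2
    _ ≤ ∫ ω, π.queue par Q₀ t ω n ^ 2 ∂μ :=
        sub_nonneg.1 ((variance_nonneg _ μ).trans_eq (variance_eq_sub hqueue))
    _ = 2 * ∫ ω, π.queue par Q₀ t ω n ^ 2 / 2 ∂μ := by rw [integral_div]; ring
    _ ≤ 2 * π.lyapunov par Q₀ μ t := by
        refine mul_le_mul_of_nonneg_left (integral_mono (hqueue.integrable_sq.div_const 2)
          (hQ₀.integrable_sum_queue_sq hH t) fun ω => ?_) zero_le_two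
        exact Finset.single_le_sum (f := fun n => π.queue par Q₀ t ω n ^ 2 / 2)
          (fun i _ => by positivity) (Finset.mem_univ n)

theorem Policy.integral_queue_sub_rate_add_rth_le (t : ℕ) (n : Fin N) :
    ∫ ω, π.queue par Q₀ t ω n ∂μ - ∫ ω, π.rate par t n ω ∂μ + par.rth ≤
      ∫ ω, π.queue par Q₀ (t + 1) ω n ∂μ := by
  have hqueue := hQ₀.integrable_queue (par := par) (π := π) hH
  have hrate := Policy.integrable_rate (par := par) (π := π) hH t n
  have hmono := integral_mono (((hqueue t n).sub hrate).add (integrable_const par.rth))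
    (hqueue (t + 1) n) fun ω => π.queue_sub_rate_add_rth_le par t ω n
  rw [integral_add' ((hqueue t n).sub hrate) (integrable_const _),
    integral_sub' (hqueue t n) hrate] at hmono
  simpa using hmono

theorem Policy.feasible_of_lyapunov_le {A B : ℝ}
    (hgrowth : ∀ t : ℕ, π.lyapunov par Q₀ μ t ≤ A + B * t) : π.Feasible par μ := by
  intro n
  refine le_liminf_average_of_tendsto (fun t => Policy.integral_rate_mem_Icc hH t n)
    (fun t => Policy.integral_queue_sub_rate_add_rth_le hH hQ₀ t n)
    (tendsto_div_atTop_of_sq_le_linear (A := 2 * (A + B)) (B := 2 * B) fun t => ?_)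
  have hsucc := hgrowth (t + 1)
  push_cast at hsucc
  linarith [Policy.sq_integral_queue_le (par := par) (π := π) hH hQ₀ (t + 1) n]

end Lyapunov

section Proposed

variable {N M K : ℕ} {Ω : Type*} {H : ℕ → Ω → Fin N → ℂ} {𝓐 : MeasurableSpace Ω}
  {par : Params N M} {π : Policy M K H 𝓐} {ν : Measure (Fin N → ℂ)} {V : ℝ}
  {Q₀ : Ω → Fin N → ℝ} {q : ℝ → ℝ} {δ : ℝ} (hπ : π.IsProposed par ν V Q₀ q)
include hπ

theorem Policy.IsProposed.subsetValue_le [IsFiniteMeasure ν] (hV : 0 ≤ V) (t : ℕ) (ω : Ω)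
    {Λ : Finset (Fin N)} (hΛ : Λ.Nonempty) (hcard : Λ.card ≤ K) :
    subsetValue par ν V (π.queue par Q₀ t ω) (π.feedback t ω) ≤
      subsetValue par ν V (π.queue par Q₀ t ω) Λ := by
  have : Nonempty (Fin M) := ⟨π.level t ω⟩
  obtain ⟨⟨hfeedback, hopt⟩, -⟩ := hπ t ω
  obtain ⟨Λ', hsub, hcard'⟩ :=
    Finset.exists_superset_card_eq hcard (hfeedback ▸ (π.feedback t ω).card_le_univ)
  exact (hopt Λ' hcard').trans (subsetValue_anti par _ ν hV hΛ hsub)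

variable (hq : ∀ p ∈ Set.Icc 0 par.pmax, |q p - p| ≤ δ)
include hq

theorem Policy.IsProposed.metric_le (hV : 0 ≤ V) (t : ℕ) (ω : Ω) :
    V * ∑ n, π.txPower par t n ω - ∑ n, π.queue par Q₀ t ω n * π.rate par t n ω ≤
      bestMetric par V (π.queue par Q₀ t ω) (π.feedback t ω) (H t ω) + 2 * δ * V := by
  obtain ⟨-, ms, hlevel, hreported, huser⟩ := hπ t ω
  have : Nonempty (Fin M) := ⟨π.level t ω⟩
  rw [π.sum_txPower, π.sum_mul_rate, hreported, ← sub_le_iff_le_add]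
  refine le_bestMetric par ⟨_, π.user_mem t ω⟩ fun n hn m => ?_
  have hquant (k : Fin N) :
      |q (par.power k (ms k) (H t ω k)) - par.power k (ms k) (H t ω k)| ≤ δ :=
    hq _ (par.power_mem_Icc _ _ _)
  have hother := mul_le_mul_of_nonneg_left (abs_le.1 (hquant n)).2 hV
  have hscheduled := mul_le_mul_of_nonneg_left (abs_le.1 (hquant (π.user t ω))).1 hV
  linarith [hlevel n hn m, huser n hn]

variable [mΩ : MeasurableSpace Ω] {μ : Measure Ω} [IsProbabilityMeasure μ]
  (hH : IsIIDChannel 𝓐 μ ν H) (hQ₀ : IsInitialQueue 𝓐 μ Q₀) (hV : 0 < V)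
include hH hQ₀ hV

theorem Policy.IsProposed.mul_meanPower_sub_le_integral_subsetValue (t : ℕ) :
    V * π.meanPower par μ t - ∫ ω, ∑ n, π.queue par Q₀ t ω n * π.rate par t n ω ∂μ ≤
      ∫ ω, subsetValue par ν V (π.queue par Q₀ t ω) (π.feedback t ω) ∂μ + 2 * δ * V := by
  have hqueue := hQ₀.integrable_queue (par := par) (π := π) hH t
  have hbest := Policy.integrable_bestMetric (par := par) (π := π) (t := t) hH hV.le
    (hQ₀.measurable_queue (par := par) (π := π) hH t) hqueue
  have hmono := integral_mono (Policy.integrable_mul_sum_txPower_sub hH hqueue)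
    (hbest.add (integrable_const (2 * δ * V))) (hπ.metric_le hq hV.le t)
  rw [Policy.integral_mul_sum_txPower_sub hH hqueue,
    integral_add' hbest (integrable_const _)] at hmono
  rw [Policy.integral_subsetValue_eq hH hV.le (π.measurable_queue par hQ₀.measurable t) hqueue]
  simpa using hmono

variable (hfeas : ∃ π : Policy M K H 𝓐, π.Feasible par μ)
include hfeas

theorem Policy.IsProposed.mul_meanPower_sub_le (t : ℕ) :
    V * π.meanPower par μ t - ∫ ω, ∑ n, π.queue par Q₀ t ω n * π.rate par t n ω ∂μ ≤
      V * optimalPower 𝓐 par K μ H - par.rth * ∫ ω, ∑ n, π.queue par Q₀ t ω n ∂μ +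
        2 * δ * V := by
  have := hH.isFiniteMeasure
  have hqueue := hQ₀.integrable_queue (par := par) (π := π) hH t
  have hsum : Integrable (fun ω => par.rth * ∑ n, π.queue par Q₀ t ω n) μ :=
    (integrable_finsetSum _ fun n _ => hqueue n).const_mul _
  have hvalue := integral_mono
    (Policy.integrable_subsetValue hH hV.le (π.measurable_queue par hQ₀.measurable t) hqueue)
    ((integrable_const (V * optimalPower 𝓐 par K μ H)).sub hsum) fun ω =>
      le_mul_optimalPower_sub hH (fun _ => hπ.subsetValue_le hV.le t ω)
        (π.queue_nonneg par hQ₀.nonneg t ω) hV hfeas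
  rw [integral_sub' (integrable_const _) hsum] at hvalue
  simp only [integral_const_mul, integral_const, probReal_univ, one_smul] at hvalue
  linarith [hπ.mul_meanPower_sub_le_integral_subsetValue hq hH hQ₀ hV t]

variable {C : ℝ} (hC : π.IsDriftConstant par μ Q₀ C)
include hC

theorem Policy.IsProposed.drift (t : ℕ) :
    π.lyapunov par Q₀ μ (t + 1) + V * π.meanPower par μ t ≤
      π.lyapunov par Q₀ μ t + (C + V * optimalPower 𝓐 par K μ H + 2 * δ * V) := by
  linarith [hC.lyapunov_succ_le hH hQ₀ t, hπ.mul_meanPower_sub_le hq hH hQ₀ hV hfeas t]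

theorem Policy.IsProposed.limsupPower_le :
    π.limsupPower par μ ≤ optimalPower 𝓐 par K μ H + C / V + 2 * δ := by
  refine limsup_average_le_of_drift (L := fun t => π.lyapunov par Q₀ μ t / V) (fun t => ?_)
    (fun t => Policy.meanPower_mem_Icc hH t) fun t => div_nonneg (Policy.lyapunov_nonneg t) hV.le
  have hdrift := div_le_div_of_nonneg_right (hπ.drift hq hH hQ₀ hV hfeas hC t) hV.le
  calc π.lyapunov par Q₀ μ (t + 1) / V + π.meanPower par μ t
    _ = (π.lyapunov par Q₀ μ (t + 1) + V * π.meanPower par μ t) / V := by field_simp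
    _ ≤ (π.lyapunov par Q₀ μ t + (C + V * optimalPower 𝓐 par K μ H + 2 * δ * V)) / V := hdrift
    _ = π.lyapunov par Q₀ μ t / V + (optimalPower 𝓐 par K μ H + C / V + 2 * δ) := by
        field_simp
        ring

theorem Policy.IsProposed.feasible : π.Feasible par μ :=
  Policy.feasible_of_lyapunov_le hH hQ₀
    (le_add_mul_of_drift (hπ.drift hq hH hQ₀ hV hfeas hC) fun t =>
      mul_nonneg hV.le (Policy.meanPower_mem_Icc hH t).1)

end Proposed

end D2D

end

theorem mainTheorem2_general {N M K : ℕ} (par : D2D.Params N M) {Ω : Type*}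
    (𝓐 : MeasurableSpace Ω) [MeasurableSpace Ω] (μ : MeasureTheory.Measure Ω)
    [MeasureTheory.IsProbabilityMeasure μ] (ν : MeasureTheory.Measure (Fin N → ℂ))
    (H : ℕ → Ω → Fin N → ℂ) (hH : D2D.IsIIDChannel 𝓐 μ ν H)
    (hfeas : ∃ π : D2D.Policy M K H 𝓐, π.Feasible par μ) :
    ∃ C₀ : ℝ, ∀ V : ℝ, 0 < V →
      ∀ Q₀ : Ω → Fin N → ℝ, Measurable[𝓐] Q₀ → (∀ ω n, 0 ≤ Q₀ ω n) →
        (∀ n, MeasureTheory.Integrable (fun ω => Q₀ ω n ^ 2) μ) →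
      ∀ (q : ℝ → ℝ) (δ : ℝ), (∀ p ∈ Set.Icc 0 par.pmax, |q p - p| ≤ δ) →
      ∀ π : D2D.Policy M K H 𝓐, π.IsProposed par ν V Q₀ q →
        π.IsDriftConstant par μ Q₀ C₀ ∧
        ∀ C : ℝ, π.IsDriftConstant par μ Q₀ C →
          D2D.optimalPower 𝓐 par K μ H ≤ π.limsupPower par μ ∧
          π.limsupPower par μ ≤ D2D.optimalPower 𝓐 par K μ H + C / V + 2 * δ := by
  refine ⟨(N * par.rth ^ 2 + par.maxRate ^ 2) / 2, fun V hV Q₀ hQm hQ₀ hQi q δ hq π hπ => ?_⟩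
  have hinit : D2D.IsInitialQueue 𝓐 μ Q₀ := ⟨hQm, hQ₀, hQi⟩
  refine ⟨D2D.Policy.isDriftConstant hH hinit, fun C hC => ⟨?_, ?_⟩⟩
  · exact (hπ.feasible hq hH hinit hV hfeas hC).optimalPower_le hH
  · exact hπ.limsupPower_le hq hH hinit hV hfeas hC

theorem mainTheorem2 {N M K : ℕ} (hK : 1 ≤ K) (hKN : K ≤ N) (par : D2D.Params N M)
    {Ω : Type*} (𝓐 : MeasurableSpace Ω) [MeasurableSpace Ω]
    (μ : MeasureTheory.Measure Ω)
    [MeasureTheory.IsProbabilityMeasure μ] (ν : MeasureTheory.Measure (Fin N → ℂ))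
    (H : ℕ → Ω → Fin N → ℂ) (hH : D2D.IsFadingModel 𝓐 μ ν H)
    (hfeas : ∃ π : D2D.Policy M K H 𝓐, π.Feasible par μ) :
    ∃ C₀ : ℝ, ∀ V : ℝ, 0 < V →
      ∀ Q₀ : Ω → Fin N → ℝ, Measurable[𝓐] Q₀ → (∀ ω n, 0 ≤ Q₀ ω n) →
        (∀ n, MeasureTheory.Integrable (fun ω => Q₀ ω n ^ 2) μ) →
      ∀ (q : ℝ → ℝ) (δ : ℝ), (∀ p ∈ Set.Icc 0 par.pmax, |q p - p| ≤ δ) →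
      ∀ π : D2D.Policy M K H 𝓐, π.IsProposed par ν V Q₀ q →
        π.IsDriftConstant par μ Q₀ C₀ ∧
        ∀ C : ℝ, π.IsDriftConstant par μ Q₀ C →
          D2D.optimalPower 𝓐 par K μ H ≤ π.limsupPower par μ ∧
          π.limsupPower par μ ≤ D2D.optimalPower 𝓐 par K μ H + C / V + 2 * δ :=
  mainTheorem2_general par 𝓐 μ ν H hH.isIIDChannel hfeas
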